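/- Let $p\ge 0$, let $\{X_t\}_{t\in\mathbb Z}$ be an $m$-variate zero-mean wide-sense stationary time series with $\Gamma_h=E(X_tX_{t-h}^\top)$, and let $A_{(i,j)}$ denote the $(i,j)$ entry of a matrix $A$. Suppose that $X$ is a causal VAR$(p+1)$, $$X_t+\Phi_{p+1,1}X_{t-1}+\cdots+\Phi_{p+1,p+1}X_{t-p-1}=\varepsilon_t ,$$ where the $\varepsilon_t$ are i.i.d. with finite second moments and a differentiable density $f_\varepsilon$, $X_t$ is measurable with respect to $\sigma(\varepsilon_{t-s}:s\ge0)$ up to null sets, and $$J_\varepsilon=E\Big[\frac{\partial\log f_\varepsilon(\varepsilon_t)}{\partial\varepsilon}\Big\{\frac{\partial\log f_\varepsilon(\varepsilon_t)}{\partial\varepsilon}\Big\}^{\top}\Big]$$ exists. The Fisher information between two scalar parameters $\alpha,\beta$ on which the coefficients depend is $E\{\partial_\alpha\log f_\varepsilon(\varepsilon_t)\,\partial_\beta\log f_\varepsilon(\varepsilon_t)\}$, evaluated at the true coefficients, where $\varepsilon_t$ is regarded as a function of the coefficients through the model equation with the data $X$ fixed. Two blocks of parameters are locally orthogonal at a point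 if all Fisher information entries between them vanish there. 1. The Fisher information between $\Phi_{p+1,r,(k,\ell)}$ and $\Phi_{p+1,s,(i,j)}$ exists and equals $\Gamma_{s-r,(\ell,j)}\,J_{\varepsilon,(k,i)}$, for all $r,s=1,\dots,p+1$ and $k,\ell,i,j=1,\dots,m$. 2. The order-$p$ forward and backward Yule--Walker systems $$\sum_{r=1}^p\Phi_{p,r}\Gamma_{s-r}=-\Gamma_s,\qquad \sum_{r=1}^p\tilde\Phi_{p,p+1-r}\Gamma_{s-r}=-\Gamma_{s-p-1},\qquad s=1,\dots,p,$$ have unique solutions $\Phi_p=(\Phi_{p,1},\dots,\Phi_{p,p})$ and $\tilde\Phi_p=(\tilde\Phi_{p,1},\dots,\tilde\Phi_{p,p})$. If $X$ also satisfies a backward VAR$(p)$ model $X_t+\Psi_1X_{t+1}+\cdots+\Psi_pX_{t+p}=\tilde\eta_t$ with i.i.d. innovations $\tilde\eta_t$ having finite second moments, $X_t$ being measurable with respect to $\sigma(\tilde\eta_{t+s}:s\ge0)$ up to null sets, then $\Psi=\tilde\Phi_p$. 3. The true coefficients satisfy the Whittle forward recursion $$\Phi_{p+1,r}=\Phi_{p,r}+\Phi_{p+1,p+1}\tilde\Phi_{p,p+1-r},\qquad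 r=1,\dots,p .$$ In the reparameterization of the VAR$(p+1)$ coefficients by $(A,B)$ in which the first $p$ coefficients are $A_r+B\,\tilde\Phi_{p,p+1-r}$, $r=1,\dots,p$, and the last one is $B$ (with $\tilde\Phi_p$ fixed), the blocks $A$ and $B$ are locally orthogonal at $(A,B)=(\Phi_p,\Phi_{p+1,p+1})$. 4. Let $(A,B)\mapsto g(A,B)=(g_1(A,B),\dots,g_p(A,B))$ be linear and consider the reparameterization of the VAR$(p+1)$ coefficients by $(A,B)\mapsto(g(A,B),B)$. Let $A^0$ be such that $(A^0,\Phi_{p+1,p+1})$ is mapped to the true coefficients. (a) If $(A,B)\mapsto(g(A,B),B)$ is bijective, then $A$ and $B$ are locally orthogonal at $(A^0,\Phi_{p+1,p+1})$ if and only if $g_r(A,B)=g_r(A,0)+B\,\tilde\Phi_{p,p+1-r}$ for all $A,B$ and $r=1,\dots,p$. (b) If $g(A,0)=A$ for all $A$ (that is, for $B=0$ the parameters are those of the VAR$(p)$ model), then $A$ and $B$ are locally orthogonal at $(A^0,\Phi_{p+1,p+1})$ if and only if $g_r(A,B)=A_r+B\,\tilde\Phi_{p,p+1-r}$ for all $A,B$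 and $r=1,\dots,p$. So Whittle's forward recursion is the unique such linear reparameterization that is locally orthogonal. The same holds backwards in time. Suppose that $X$ (stationary and zero-mean as above) satisfies a backward VAR$(p+1)$ model $X_t+\tilde\Phi_{p+1,1}X_{t+1}+\cdots+\tilde\Phi_{p+1,p+1}X_{t+p+1}=\tilde\varepsilon_t$ with i.i.d. innovations subject to the same assumptions, $X_t$ being measurable with respect to $\sigma(\tilde\varepsilon_{t+s}:s\ge0)$ up to null sets. Then the Fisher information between $\tilde\Phi_{p+1,r,(k,\ell)}$ and $\tilde\Phi_{p+1,s,(i,j)}$ exists and equals $\Gamma_{r-s,(\ell,j)}J_{\tilde\varepsilon,(k,i)}$. The two systems in 2 have unique solutions $\Phi_p$ and $\tilde\Phi_p$, and the coefficients of any forward VAR$(p)$ model of $X$ (causal, with i.i.d. innovations having finite second moments) are $\Phi_p$. Finally, 3 and 4 hold with the roles of forward and backward coefficients exchanged, that is, with the backward recursion $$\tilde\Phi_{p+1,r}=\tilde\Phi_{p,r}+\tilde\Phi_{p+1,p+1}\Phi_{p,p+1-r},\qquad r=1,\dots,p .$$ -/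

import Mathlib

open MeasureTheory ProbabilityTheory
open scoped Matrix

noncomputable section

namespace WhittleVAR

/-- Coefficient tuples of an `m`-variate autoregression of order `q`.
The index `r : Fin q` stands for the lag `r + 1`. -/
abbrev Coeffs (m q : ℕ) : Type := Fin q → Matrix (Fin m) (Fin m) ℝ

variable {Ω : Type*} {m p q : ℕ}

/-- The series run backwards in time. -/
def timeReverse (X : ℤ → Ω → Fin m → ℝ) : ℤ → Ω → Fin m → ℝ := fun t => X (-t)

/-- The residual `X_t + A_1 X_{t-1} + ⋯ + A_q X_{t-q}`. -/
def residual (X : ℤ → Ω → Fin m → ℝ) (A : Coeffs m q) (t : ℤ) (ω : Ω) : Fin m → ℝ :=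
  X t ω + ∑ r : Fin q, A r *ᵥ X (t - ((r : ℤ) + 1)) ω

/-- The σ-algebra generated by `ε_t, ε_{t-1}, ε_{t-2}, …`. -/
@[reducible] def past (ε : ℤ → Ω → Fin m → ℝ) (t : ℤ) : MeasurableSpace Ω :=
  ⨆ s : ℕ, MeasurableSpace.comap (ε (t - (s : ℤ))) inferInstance

/-- The autocovariance matrices `Γ_h = E (X_t X_{t-h}ᵀ)` of a zero-mean (wide-sense) stationary
series, computed at `t = 0`. -/
def autocov [MeasurableSpace Ω] (P : Measure Ω) (X : ℤ → Ω → Fin m → ℝ) (h : ℤ) :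
    Matrix (Fin m) (Fin m) ℝ :=
  Matrix.of fun i j => ∫ ω, X 0 ω i * X (0 - h) ω j ∂P

/-- A zero-mean wide-sense stationary `m`-variate time series. -/
structure IsStationary [MeasurableSpace Ω] (P : Measure Ω) (X : ℤ → Ω → Fin m → ℝ) : Prop where
  memLp : ∀ t, MemLp (X t) 2 P
  mean_zero : ∀ t i, ∫ ω, X t ω i ∂P = 0
  cov_eq : ∀ s t h i j,
    ∫ ω, X t ω i * X (t - h) ω j ∂P = ∫ ω, X s ω i * X (s - h) ω j ∂P

/-- `X` is a stationary zero-mean VAR(`q`) with coefficients `Φ` and i.i.d. innovations `ε`,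
`X_t` being a function of the present and past innovations. -/
structure IsVAR [MeasurableSpace Ω] (P : Measure Ω) (X ε : ℤ → Ω → Fin m → ℝ)
    (Φ : Coeffs m q) : Prop where
  stationary : IsStationary P X
  measurable_innov : ∀ t, Measurable (ε t)
  indep : iIndepFun ε P
  identDistrib : ∀ s t, IdentDistrib (ε s) (ε t) P P
  innov_memLp : ∀ t, MemLp (ε t) 2 P
  equation : ∀ t, ∀ᵐ ω ∂P, residual X Φ t ω = ε t ω
  causal : ∀ t, AEStronglyMeasurable[past ε t] (X t) P

/-- The law on `ℝᵐ` with Lebesgue density `f`. -/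
def law (f : (Fin m → ℝ) → ℝ) : Measure (Fin m → ℝ) :=
  volume.withDensity fun x => ENNReal.ofReal (f x)

/-- The partial derivative `∂ log f / ∂ x_k`. -/
def densityScore (f : (Fin m → ℝ) → ℝ) (k : Fin m) (x : Fin m → ℝ) : ℝ :=
  fderiv ℝ (fun y => Real.log (f y)) x (Pi.single k 1)

/-- `J = E [ (∂ log f(ε) / ∂ε) (∂ log f(ε) / ∂ε)ᵀ ]` for `ε` with density `f`. -/
def innovInfo (f : (Fin m → ℝ) → ℝ) : Matrix (Fin m) (Fin m) ℝ :=
  Matrix.of fun k i => ∫ x, densityScore f k x * densityScore f i x ∂(law f)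

/-- The innovations have the differentiable probability density `f`, for which the matrix
`innovInfo f` exists (the components of the score are square integrable). -/
structure HasInnovDensity [MeasurableSpace Ω] (P : Measure Ω) (ε : ℤ → Ω → Fin m → ℝ)
    (f : (Fin m → ℝ) → ℝ) : Prop where
  nonneg : ∀ x, 0 ≤ f x
  differentiable : Differentiable ℝ f
  map_eq : ∀ t, P.map (ε t) = law f
  score_memLp : ∀ k, MemLp (densityScore f k) 2 (law f)

/-- The log-likelihood contribution `log f(ε_t)` of time `t`, where `ε_t` is regarded as the
function `A ↦ X_t + ∑ A_r X_{t-r}` of the coefficients. -/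
def logLik (f : (Fin m → ℝ) → ℝ) (X : ℤ → Ω → Fin m → ℝ) (t : ℤ) (ω : Ω)
    (A : Coeffs m q) : ℝ :=
  Real.log (f (residual X A t ω))

/-- In the parameterization `A = θ x` of the coefficients by a vector `x`, the partial derivative
of the log-likelihood at `x` in the (coordinate) direction `v`. -/
def score {E : Type*} [AddCommGroup E] [Module ℝ E] (f : (Fin m → ℝ) → ℝ)
    (X : ℤ → Ω → Fin m → ℝ) (θ : E → Coeffs m q) (x v : E) (t : ℤ) (ω : Ω) : ℝ :=
  deriv (fun a : ℝ => logLik f X t ω (θ (x + a • v))) 0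

/-- The Fisher information between the coordinates `v` and `w`, at the parameter value `x` of the
parameterization `θ`, is defined and has the value `c`. -/
def HasFisherInfo {E : Type*} [AddCommGroup E] [Module ℝ E] [MeasurableSpace Ω] (P : Measure Ω)
    (f : (Fin m → ℝ) → ℝ) (X : ℤ → Ω → Fin m → ℝ) (θ : E → Coeffs m q) (t : ℤ)
    (x v w : E) (c : ℝ) : Prop :=
  Integrable (fun ω => score f X θ x v t ω * score f X θ x w t ω) P ∧
    ∫ ω, score f X θ x v t ω * score f X θ x w t ω ∂P = c

/-- The coordinate direction of the `(k, l)` entry of the coefficient matrix with index `r`. -/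
def entryDir (r : Fin q) (k l : Fin m) : Coeffs m q := Pi.single r (Matrix.single k l 1)

/-- The VAR(`p+1`) coefficients `(g(A, B), B)` given by a transformation `g` for the first `p`
of them; `A` plays the role of `Φ_p`, and `B` that of `Φ_{p+1,p+1}`. -/
def reparam (g : Coeffs m p × Matrix (Fin m) (Fin m) ℝ → Coeffs m p)
    (x : Coeffs m p × Matrix (Fin m) (Fin m) ℝ) : Coeffs m (p + 1) :=
  Fin.snoc (α := fun _ => Matrix (Fin m) (Fin m) ℝ) (g x) x.2

/-- In the parameterization `reparam g`, the blocks `A` and `B` are locally orthogonal at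
`x = (A, B)`: all Fisher information entries between an entry of `A` and one of `B` vanish. -/
def LocallyOrthogonal [MeasurableSpace Ω] (P : Measure Ω) (f : (Fin m → ℝ) → ℝ)
    (X : ℤ → Ω → Fin m → ℝ) (t : ℤ)
    (g : Coeffs m p × Matrix (Fin m) (Fin m) ℝ → Coeffs m p)
    (x : Coeffs m p × Matrix (Fin m) (Fin m) ℝ) : Prop :=
  ∀ (s : Fin p) (i j u v : Fin m),
    HasFisherInfo P f X (reparam g) t x (entryDir s i j, 0) (0, Matrix.single u v 1) 0

/-- The forward system `(Φ_1 ⋯ Φ_p) T = -(Γ_1 ⋯ Γ_p)`, where `T` is the block Toeplitz matrix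
with blocks `T_{r,s} = Γ_{s-r}`. -/
def ForwardYuleWalker (Γ : ℤ → Matrix (Fin m) (Fin m) ℝ) (Φ : Coeffs m p) : Prop :=
  ∀ s : Fin p, ∑ r : Fin p, Φ r * Γ ((s : ℤ) - (r : ℤ)) = -Γ ((s : ℤ) + 1)

/-- The backward system `(Ψ_p ⋯ Ψ_1) T = -(Γ_{-p} ⋯ Γ_{-1})`. The index `r.rev` stands for the
lag `p + 1 - (r + 1)`. -/
def BackwardYuleWalker (Γ : ℤ → Matrix (Fin m) (Fin m) ℝ) (Ψ : Coeffs m p) : Prop :=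
  ∀ s : Fin p, ∑ r : Fin p, Ψ r.rev * Γ ((s : ℤ) - (r : ℤ)) = -Γ ((s : ℤ) - (p : ℤ))

/-- The Whittle transformation `(A, B) ↦ (A_r + B Ψ_{p+1-r})_{r = 1, …, p}`. -/
def whittle (Ψ : Coeffs m p) (x : Coeffs m p × Matrix (Fin m) (Fin m) ℝ) : Coeffs m p :=
  fun r => x.1 r + x.2 * Ψ r.rev

end WhittleVAR

end

/-!
The residual of a causal autoregression is affine in the coefficients, so its log-likelihood has,
in the direction `V` of coefficient space, the score
`∇ log f(ε_t) ⬝ (V_1 X_{t-1} + V_2 X_{t-2} + ⋯)`.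
The innovation `ε_t` is independent of the lagged values (`indepFun_of_past`), whence the Fisher
information between the directions `V` and `W` is `∑ tr (V_r Γ_{s-r} W_sᵀ J)`
(`hasFisherInfo_infoForm`). Two nondegeneracy facts are needed to exploit this formula.

* The block Toeplitz matrix of the autocovariances is nonsingular (`IsVAR.toeplitz_injective`).
  If `∑ C_r X_{t-r}` is zero, its covariance with `ε_{t-1}` is `C_1 E (ε εᵀ)`, so that `C_1 = 0`,
  because a law with a density is not carried by a hyperplane; then `C_2 = 0`, and so on.
* The matrix `J` is nonsingular (`eq_zero_of_ae_dotProduct_densityScore`). If `c ⬝ ∇ log f` is zero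
  almost surely, then `c ⬝ ∇ f` is zero almost everywhere, and as `f` is differentiable everywhere
  it can be recovered from this derivative along almost every line parallel to `c`. The law of the
  innovations is then invariant under the translations along `c`, which forces `c = 0`.

The Yule-Walker systems are Toeplitz systems, so they have unique solutions, and Whittle's recursion
is a linear identity between their solutions (`whittle_recursion`). For a linear reparameterization
with `g(·, 0)` onto, the entries between `A` and `B` are `tr (g(A, 0)_r D_rᵀ J)`, where
`D_r` is the covariance of `g(0, B)_1 X_{t-1} + ⋯ + g(0, B)_p X_{t-p} + B X_{t-p-1}` with `X_{t-r}`.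
They all vanish if and only if `D = 0`, that is, if `g(0, B)_r = B Ψ_{p+1-r}` with the backward
coefficients `Ψ` (`locallyOrthogonal_iff`). The backward statements are the forward ones for the
series run backwards in time, for which the forward and backward systems are interchanged.
-/

noncomputable section

namespace WhittleVAR

section CrossMoment

/-! ### Matrices of second moments -/

variable {Ω ι : Type*} [MeasurableSpace Ω] {P : Measure Ω} {m : ℕ}

/-- The matrix `E (Y Zᵀ)` of two random vectors. It is only meaningful for square integrable
`Y` and `Z`, since the entries are Bochner integrals. -/
def crossMoment (P : Measure Ω) (Y Z : Ω → Fin m → ℝ) : Matrix (Fin m) (Fin m) ℝ :=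
  Matrix.of fun i j => ∫ ω, Y ω i * Z ω j ∂P

lemma integrable_mul_apply {Y Z : Ω → Fin m → ℝ} (hY : MemLp Y 2 P) (hZ : MemLp Z 2 P)
    (i j : Fin m) : Integrable (fun ω => Y ω i * Z ω j) P :=
  (hY.eval i).integrable_mul (hZ.eval j)

lemma memLp_mulVec {Y : Ω → Fin m → ℝ} (hY : MemLp Y 2 P) (A : Matrix (Fin m) (Fin m) ℝ) :
    MemLp (fun ω => A *ᵥ Y ω) 2 P :=
  memLp_pi_iff.2 fun i => by
    simp only [Matrix.mulVec, dotProduct]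
    exact memLp_finsetSum _ fun j _ => (hY.eval j).const_mul _

lemma memLp_sum_mulVec {s : Finset ι} {Y : ι → Ω → Fin m → ℝ} (hY : ∀ r, MemLp (Y r) 2 P)
    (A : ι → Matrix (Fin m) (Fin m) ℝ) : MemLp (fun ω => ∑ r ∈ s, A r *ᵥ Y r ω) 2 P :=
  memLp_finsetSum _ fun r _ => memLp_mulVec (hY r) (A r)

lemma crossMoment_congr {Y Y' Z Z' : Ω → Fin m → ℝ} (hY : Y =ᵐ[P] Y') (hZ : Z =ᵐ[P] Z') :
    crossMoment P Y Z = crossMoment P Y' Z' := by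
  ext i j
  refine integral_congr_ae ?_
  filter_upwards [hY, hZ] with ω h h'
  rw [h, h']

lemma crossMoment_transpose (Y Z : Ω → Fin m → ℝ) :
    (crossMoment P Y Z)ᵀ = crossMoment P Z Y := by
  ext i j
  simp [crossMoment, mul_comm]

lemma crossMoment_add_left {Y Y' Z : Ω → Fin m → ℝ} (hY : MemLp Y 2 P) (hY' : MemLp Y' 2 P)
    (hZ : MemLp Z 2 P) :
    crossMoment P (fun ω => Y ω + Y' ω) Z = crossMoment P Y Z + crossMoment P Y' Z := by
  ext i j
  simp only [crossMoment, Matrix.of_apply, Matrix.add_apply, Pi.add_apply, add_mul]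
  exact integral_add (integrable_mul_apply hY hZ i j) (integrable_mul_apply hY' hZ i j)

lemma crossMoment_mulVec_left {Y Z : Ω → Fin m → ℝ} (hY : MemLp Y 2 P)
    (hZ : MemLp Z 2 P) (A : Matrix (Fin m) (Fin m) ℝ) :
    crossMoment P (fun ω => A *ᵥ Y ω) Z = A * crossMoment P Y Z := by
  ext i j
  simp only [crossMoment, Matrix.of_apply, Matrix.mul_apply, Matrix.mulVec, dotProduct,
    Finset.sum_mul, mul_assoc]
  rw [integral_finsetSum _ fun k _ => (integrable_mul_apply hY hZ k j).const_mul _]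
  simp_rw [integral_const_mul]

lemma crossMoment_sum_mulVec_left (s : Finset ι) {Y : ι → Ω → Fin m → ℝ} {Z : Ω → Fin m → ℝ}
    (hY : ∀ r, MemLp (Y r) 2 P) (hZ : MemLp Z 2 P) (A : ι → Matrix (Fin m) (Fin m) ℝ) :
    crossMoment P (fun ω => ∑ r ∈ s, A r *ᵥ Y r ω) Z = ∑ r ∈ s, A r * crossMoment P (Y r) Z := by
  classical
  induction s using Finset.induction_on with
  | empty => ext; simp [crossMoment]
  | insert a s ha ih =>
    simp only [Finset.sum_insert ha]
    rw [crossMoment_add_left (memLp_mulVec (hY a) _) (memLp_sum_mulVec hY A) hZ, ih,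
      crossMoment_mulVec_left (hY a) hZ]

lemma crossMoment_mulVec_right {Y Z : Ω → Fin m → ℝ} (hY : MemLp Y 2 P)
    (hZ : MemLp Z 2 P) (A : Matrix (Fin m) (Fin m) ℝ) :
    crossMoment P Y (fun ω => A *ᵥ Z ω) = crossMoment P Y Z * Aᵀ := by
  rw [← crossMoment_transpose, crossMoment_mulVec_left hZ hY, Matrix.transpose_mul,
    crossMoment_transpose]

lemma crossMoment_sum_mulVec_right (s : Finset ι) {Z : ι → Ω → Fin m → ℝ} {Y : Ω → Fin m → ℝ}
    (hY : MemLp Y 2 P) (hZ : ∀ r, MemLp (Z r) 2 P) (A : ι → Matrix (Fin m) (Fin m) ℝ) :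
    crossMoment P Y (fun ω => ∑ r ∈ s, A r *ᵥ Z r ω) =
      ∑ r ∈ s, crossMoment P Y (Z r) * (A r)ᵀ := by
  rw [← crossMoment_transpose, crossMoment_sum_mulVec_left s hZ hY, Matrix.transpose_sum]
  simp [Matrix.transpose_mul, crossMoment_transpose]

lemma ae_eq_zero_of_crossMoment_self {Y : Ω → Fin m → ℝ} (hY : MemLp Y 2 P)
    (h : crossMoment P Y Y = 0) : ∀ᵐ ω ∂P, Y ω = 0 := by
  have key : ∀ i, ∀ᵐ ω ∂P, Y ω i = 0 := fun i => by
    have h0 : ∫ ω, Y ω i * Y ω i ∂P = 0 := congrFun (congrFun h i) i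
    rw [integral_eq_zero_iff_of_nonneg (fun ω => mul_self_nonneg _)
      (integrable_mul_apply hY hY i i)] at h0
    filter_upwards [h0] with ω hω
    exact mul_self_eq_zero.1 hω
  filter_upwards [ae_all_iff.2 key] with ω hω
  exact funext hω

/-- If the components of `Y` are linearly independent modulo null functions, then the Gram matrix
`E (Y Yᵀ)` can be cancelled. -/
lemma eq_zero_of_mul_crossMoment_self {Y : Ω → Fin m → ℝ} (hY : MemLp Y 2 P)
    (hY0 : ∀ c : Fin m → ℝ, (∀ᵐ ω ∂P, c ⬝ᵥ Y ω = 0) → c = 0)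
    {A : Matrix (Fin m) (Fin m) ℝ} (hA : A * crossMoment P Y Y = 0) : A = 0 := by
  have h := ae_eq_zero_of_crossMoment_self (memLp_mulVec hY A) (by
    rw [crossMoment_mulVec_left hY (memLp_mulVec hY A), crossMoment_mulVec_right hY hY,
      ← mul_assoc, hA, zero_mul])
  funext i
  refine hY0 (A i) ?_
  filter_upwards [h] with ω hω
  exact congrFun hω i

end CrossMoment

section Density

/-! ### Nondegeneracy of the innovation density and of its information matrix -/

variable {m : ℕ} {f : (Fin m → ℝ) → ℝ}

lemma ae_law_iff (hd : Differentiable ℝ f) {p : (Fin m → ℝ) → Prop} :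
    (∀ᵐ x ∂(law f), p x) ↔ ∀ᵐ x, 0 < f x → p x := by
  rw [law, ae_withDensity_iff hd.continuous.measurable.ennreal_ofReal]
  simp

lemma eq_zero_of_ae_dotProduct_eq_zero [IsProbabilityMeasure (law f)] {c : Fin m → ℝ}
    (h : ∀ᵐ x ∂(law f), c ⬝ᵥ x = 0) : c = 0 := by
  by_contra hc
  let S : Submodule ℝ (Fin m → ℝ) := LinearMap.ker (dotProductBilin ℝ ℝ c)
  have hS : S ≠ ⊤ := fun hS => hc <| by
    have : c ∈ S := hS ▸ Submodule.mem_top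
    exact dotProduct_self_eq_zero.1 this
  have h1 : law f S = 0 :=
    withDensity_absolutelyContinuous _ _ (Measure.addHaar_submodule volume S hS)
  have h2 : law f (S : Set (Fin m → ℝ))ᶜ = 0 := h
  have h3 := measure_union_le (μ := law f) (S : Set (Fin m → ℝ)) (S : Set (Fin m → ℝ))ᶜ
  rw [Set.union_compl_self, h1, h2, measure_univ] at h3
  simp at h3

/-- A probability measure on `ℝᵐ` is not invariant under all translations along a line: its
image under a linear form that is not constant on the line would have a constant distribution
function. -/
lemma eq_zero_of_map_add_smul_eq (μ : Measure (Fin m → ℝ)) [IsProbabilityMeasure μ]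
    {c : Fin m → ℝ} (h : ∀ a : ℝ, μ.map (fun x => x + a • c) = μ) : c = 0 := by
  by_contra hc
  have hcc : c ⬝ᵥ c ≠ 0 := fun h0 => hc (dotProduct_self_eq_zero.1 h0)
  have hm : Measurable fun x : Fin m → ℝ => c ⬝ᵥ x := by
    unfold dotProduct; fun_prop
  have : IsProbabilityMeasure (μ.map fun x => c ⬝ᵥ x) :=
    Measure.isProbabilityMeasure_map hm.aemeasurable
  have hconst : ∀ b, cdf (μ.map fun x => c ⬝ᵥ x) b = cdf (μ.map fun x => c ⬝ᵥ x) 0 := fun b => by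
    rw [cdf_eq_real, cdf_eq_real, map_measureReal_apply hm measurableSet_Iic,
      map_measureReal_apply hm measurableSet_Iic]
    conv_lhs => rw [← h (b / (c ⬝ᵥ c))]
    rw [map_measureReal_apply (by fun_prop) (hm measurableSet_Iic)]
    congr 1
    ext x
    simp [dotProduct_add, hcc]
  have h0 := tendsto_cdf_atBot (μ.map fun x => c ⬝ᵥ x)
  have h1 := tendsto_cdf_atTop (μ.map fun x => c ⬝ᵥ x)
  have e : (cdf (μ.map fun x => c ⬝ᵥ x) : ℝ → ℝ) = fun _ => cdf (μ.map fun x => c ⬝ᵥ x) 0 :=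
    funext hconst
  rw [e] at h0 h1
  have h0' := tendsto_nhds_unique h0 tendsto_const_nhds
  have h1' := tendsto_nhds_unique h1 tendsto_const_nhds
  linarith

/-- A differentiable function whose derivative in a direction vanishes almost everywhere is
almost everywhere unchanged by translations in this direction. -/
lemma ae_add_smul_eq_of_ae_fderiv_eq_zero (hd : Differentiable ℝ f) {c : Fin m → ℝ}
    (h : ∀ᵐ x, fderiv ℝ f x c = 0) (a : ℝ) : ∀ᵐ x, f (x + a • c) = f x := by
  have hm : Measurable fun x => fderiv ℝ f x c := measurable_fderiv_apply_const ℝ f c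
  have h2 : ∀ᵐ x : Fin m → ℝ, ∀ᵐ s : ℝ, fderiv ℝ f (x + s • c) c = 0 := by
    rw [Measure.ae_ae_comm]
    · exact Filter.Eventually.of_forall fun s =>
        (measurePreserving_add_right volume (s • c)).quasiMeasurePreserving.ae h
    · exact (hm.comp (by fun_prop : Measurable
        fun z : (Fin m → ℝ) × ℝ => z.1 + z.2 • c)) (measurableSet_singleton 0)
  filter_upwards [h2] with x hx
  have hx' : (fun s : ℝ => fderiv ℝ f (x + s • c) c) =ᵐ[volume] fun _ => 0 := hx
  -- the derivative along the line exists everywhere and is integrable, so it can be integrated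
  have hder : ∀ s : ℝ, HasDerivAt (fun s : ℝ => f (x + s • c)) (fderiv ℝ f (x + s • c) c) s := by
    intro s
    have h1 : HasDerivAt (fun s : ℝ => x + s • c) c s := by
      simpa using ((hasDerivAt_id s).smul_const c).const_add x
    exact (hd _).hasFDerivAt.comp_hasDerivAt s h1
  have hint : IntervalIntegrable (fun s : ℝ => fderiv ℝ f (x + s • c) c) volume 0 a :=
    ((integrable_zero ℝ ℝ volume).congr hx'.symm).intervalIntegrable
  have h3 := intervalIntegral.integral_eq_sub_of_hasDerivAt (fun s _ => hder s) hint
  rw [intervalIntegral.integral_congr_ae (g := fun _ => (0 : ℝ))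
    (hx.mono fun s hs _ => hs)] at h3
  simp only [intervalIntegral.integral_zero, zero_smul, add_zero] at h3
  linarith

lemma densityScore_eq {x : Fin m → ℝ} (hd : Differentiable ℝ f) (hx : 0 < f x) (k : Fin m) :
    densityScore f k x = (f x)⁻¹ * fderiv ℝ f x (Pi.single k 1) := by
  rw [densityScore, fderiv.log (hd x) hx.ne']
  rfl

lemma clm_apply_eq_sum (L : (Fin m → ℝ) →L[ℝ] ℝ) (c : Fin m → ℝ) :
    L c = ∑ k, c k * L (Pi.single k 1) := by
  conv_lhs => rw [pi_eq_sum_univ' c]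
  simp [map_sum]

/-- The components of the score of a differentiable density are linearly independent: if
`c ⬝ ∇ log f` vanishes where `f > 0`, then `c ⬝ ∇ f` vanishes almost everywhere, as `f` has a
minimum wherever it is zero. So `f` is invariant under translations along `c`. -/
lemma eq_zero_of_ae_dotProduct_densityScore (h0 : ∀ x, 0 ≤ f x) (hd : Differentiable ℝ f)
    [IsProbabilityMeasure (law f)] {c : Fin m → ℝ}
    (h : ∀ᵐ x ∂(law f), c ⬝ᵥ (fun k => densityScore f k x) = 0) : c = 0 := by
  rw [ae_law_iff hd] at h
  have h1 : ∀ᵐ x, fderiv ℝ f x c = 0 := by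
    filter_upwards [h] with x hx
    rcases (h0 x).eq_or_lt with h2 | h2
    · rw [IsLocalMin.fderiv_eq_zero (Filter.Eventually.of_forall fun y => h2 ▸ h0 y)]
      rfl
    · have h3 := hx h2
      simp only [dotProduct, densityScore_eq hd h2] at h3
      rw [clm_apply_eq_sum]
      have : (f x)⁻¹ * ∑ k, c k * fderiv ℝ f x (Pi.single k 1) = 0 := by
        rw [← h3, Finset.mul_sum]
        exact Finset.sum_congr rfl fun k _ => by ring
      exact (mul_eq_zero.1 this).resolve_left (inv_ne_zero h2.ne')
  refine eq_zero_of_map_add_smul_eq (law f) fun a => ?_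
  -- Lebesgue measure is translation invariant and `f` is unchanged, so the law is invariant
  ext s hs
  have hma : Measurable fun x : Fin m → ℝ => x + a • c := by fun_prop
  rw [Measure.map_apply hma hs, law, withDensity_apply _ (hma hs), withDensity_apply _ hs,
    ← lintegral_indicator (hma hs), ← lintegral_indicator hs,
    ← lintegral_add_right_eq_self (s.indicator fun x => ENNReal.ofReal (f x)) (a • c)]
  refine lintegral_congr_ae ?_
  filter_upwards [ae_add_smul_eq_of_ae_fderiv_eq_zero hd h1 a] with x hx
  classical
  simp only [Set.indicator_apply, Set.mem_preimage, hx]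

end Density

section

/-! ### Residuals, pasts and block Toeplitz systems -/

variable {Ω : Type*} {m p q : ℕ}

/-- The contribution `A_1 X_{t-1} + ⋯ + A_q X_{t-q}` of the lagged values to the residual. -/
def lagSum (X : ℤ → Ω → Fin m → ℝ) (A : Coeffs m q) (t : ℤ) (ω : Ω) : Fin m → ℝ :=
  ∑ r : Fin q, A r *ᵥ X (t - ((r : ℤ) + 1)) ω

lemma timeReverse_timeReverse (X : ℤ → Ω → Fin m → ℝ) : timeReverse (timeReverse X) = X := by
  ext; simp [timeReverse]

lemma past_mono (ε : ℤ → Ω → Fin m → ℝ) {s t : ℤ} (h : s ≤ t) : past ε s ≤ past ε t := by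
  refine iSup_le fun n => ?_
  have h1 : t - ((n + (t - s).toNat : ℕ) : ℤ) = s - (n : ℤ) := by push_cast; omega
  rw [← h1]
  exact le_iSup (fun s : ℕ => MeasurableSpace.comap (ε (t - (s : ℤ))) inferInstance) _

lemma residual_add_smul (X : ℤ → Ω → Fin m → ℝ) (A V : Coeffs m q) (a : ℝ) (t : ℤ) (ω : Ω) :
    residual X (A + a • V) t ω = residual X A t ω + a • lagSum X V t ω := by
  simp [residual, lagSum, Matrix.add_mulVec, Matrix.smul_mulVec, Finset.sum_add_distrib,
    Finset.smul_sum, add_assoc]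

/-- The left-hand side `(C_1 ⋯ C_p) T` of the Yule-Walker systems, with `T` the block Toeplitz
matrix with blocks `T_{r,s} = Γ_{s-r}`. -/
def toeplitz (Γ : ℤ → Matrix (Fin m) (Fin m) ℝ) : Coeffs m p →ₗ[ℝ] Coeffs m p where
  toFun C s := ∑ r : Fin p, C r * Γ ((s : ℤ) - (r : ℤ))
  map_add' C D := by ext1 s; simp [add_mul, Finset.sum_add_distrib]
  map_smul' a C := by ext1 s; simp [Finset.smul_sum]

lemma toeplitz_apply (Γ : ℤ → Matrix (Fin m) (Fin m) ℝ) (C : Coeffs m p) (s : Fin p) :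
    toeplitz Γ C s = ∑ r : Fin p, C r * Γ ((s : ℤ) - (r : ℤ)) := rfl

/-! ### Yule-Walker systems -/

section YuleWalker

variable {Γ : ℤ → Matrix (Fin m) (Fin m) ℝ}

lemma forwardYuleWalker_iff {Φ : Coeffs m p} :
    ForwardYuleWalker Γ Φ ↔ toeplitz Γ Φ = fun s : Fin p => -Γ ((s : ℤ) + 1) :=
  funext_iff.symm

lemma backwardYuleWalker_iff {Ψ : Coeffs m p} :
    BackwardYuleWalker Γ Ψ ↔
      toeplitz Γ (fun r => Ψ r.rev) = fun s : Fin p => -Γ ((s : ℤ) - (p : ℤ)) :=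
  funext_iff.symm

lemma cast_rev (r : Fin p) : ((r.rev : Fin p) : ℤ) = (p : ℤ) - 1 - (r : ℤ) := by
  rw [Fin.val_rev]; omega

/-- Reversing time interchanges the two systems. -/
lemma backwardYuleWalker_iff_forward_neg {Ψ : Coeffs m p} :
    BackwardYuleWalker Γ Ψ ↔ ForwardYuleWalker (fun h => Γ (-h)) Ψ := by
  rw [BackwardYuleWalker, ForwardYuleWalker, ← Fin.revPerm.forall_congr_right]
  refine forall_congr' fun s => ?_
  rw [← Equiv.sum_comp Fin.revPerm]
  simp only [Fin.revPerm_apply, Fin.rev_rev, cast_rev]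
  rw [show (p : ℤ) - 1 - (s : ℤ) - p = -((s : ℤ) + 1) by ring]
  simp only [show ∀ r : Fin p, (p : ℤ) - 1 - (s : ℤ) - (p - 1 - (r : ℤ)) = -((s : ℤ) - (r : ℤ))
    from fun r => by ring]

lemma forwardYuleWalker_iff_backward_neg {Φ : Coeffs m p} :
    ForwardYuleWalker Γ Φ ↔ BackwardYuleWalker (fun h => Γ (-h)) Φ := by
  simp [backwardYuleWalker_iff_forward_neg]

lemma toeplitz_bijective (h : Function.Injective (toeplitz (p := p) Γ)) :
    Function.Bijective (toeplitz (p := p) Γ) :=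
  ⟨h, LinearMap.injective_iff_surjective.1 h⟩

lemma existsUnique_forwardYuleWalker (h : Function.Injective (toeplitz (p := p) Γ)) :
    ∃! Φ : Coeffs m p, ForwardYuleWalker Γ Φ := by
  simp only [forwardYuleWalker_iff]
  exact (toeplitz_bijective h).existsUnique _

lemma existsUnique_backwardYuleWalker (h : Function.Injective (toeplitz (p := p) Γ)) :
    ∃! Ψ : Coeffs m p, BackwardYuleWalker Γ Ψ := by
  simp only [backwardYuleWalker_iff]
  obtain ⟨C, hC, hC'⟩ :=
    (toeplitz_bijective h).existsUnique fun s : Fin p => -Γ ((s : ℤ) - (p : ℤ))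
  refine ⟨fun r => C r.rev, by simpa using hC, fun Ψ hΨ => ?_⟩
  ext1 r
  simpa using congrFun (hC' _ hΨ) r.rev

/-- If `C_1 X_{t-1} + ⋯ + C_p X_{t-p} + B X_{t-p-1}` is uncorrelated with `X_{t-1}, …, X_{t-p}`,
then it is `B` times the backward prediction error of `X_{t-p-1}`. -/
lemma eq_mul_backward_of_sum_eq_zero (h : Function.Injective (toeplitz (p := p) Γ))
    {Ψ C : Coeffs m p} {B : Matrix (Fin m) (Fin m) ℝ} (hΨ : BackwardYuleWalker Γ Ψ)
    (hC : ∀ s : Fin p, toeplitz Γ C s + B * Γ ((s : ℤ) - (p : ℤ)) = 0) (r : Fin p) :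
    C r = B * Ψ r.rev := by
  refine congrFun (a := r) (h (?_ : toeplitz Γ C = toeplitz Γ fun r => B * Ψ r.rev))
  ext1 s
  have h2 : toeplitz Γ (fun r => B * Ψ r.rev) s = B * ∑ r : Fin p, Ψ r.rev * Γ ((s : ℤ) - r) := by
    rw [toeplitz_apply, Finset.mul_sum]
    simp only [mul_assoc]
  rw [h2, hΨ s, mul_neg]
  exact eq_neg_of_add_eq_zero_left (hC s)

/-- Whittle's recursion. The first `p` equations of the system of order `p + 1`, minus the system
of order `p`, say that `C_r = Φ_{p+1,r} - Φ_{p,r}` and `B = Φ_{p+1,p+1}` are as in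
`eq_mul_backward_of_sum_eq_zero`. -/
lemma whittle_recursion (h : Function.Injective (toeplitz (p := p) Γ))
    {Φ : Coeffs m (p + 1)} {Φp Ψp : Coeffs m p} (hΦ : ForwardYuleWalker Γ Φ)
    (hΦp : ForwardYuleWalker Γ Φp) (hΨp : BackwardYuleWalker Γ Ψp) (r : Fin p) :
    Φ r.castSucc = Φp r + Φ (Fin.last p) * Ψp r.rev := by
  rw [← sub_eq_iff_eq_add']
  refine eq_mul_backward_of_sum_eq_zero h (C := (fun r => Φ r.castSucc) - Φp) hΨp (fun s => ?_) r
  have h1 := hΦ s.castSucc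
  have h2 := hΦp s
  rw [Fin.sum_univ_castSucc] at h1
  simp only [Fin.val_castSucc, Fin.val_last] at h1
  rw [map_sub, Pi.sub_apply, toeplitz_apply, toeplitz_apply, h2, sub_neg_eq_add, add_right_comm,
    h1, neg_add_cancel]

end YuleWalker

/-! ### Second moments of a causal autoregression -/

section Moments

variable [MeasurableSpace Ω] {P : Measure Ω} {X ε : ℤ → Ω → Fin m → ℝ} {Φ : Coeffs m q}

lemma IsStationary.crossMoment_eq (hX : IsStationary P X) (s t : ℤ) :
    crossMoment P (X s) (X t) = autocov P X (s - t) := by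
  ext i j
  have := hX.cov_eq 0 s (s - t) i j
  rwa [sub_sub_cancel] at this

lemma IsStationary.autocov_transpose (hX : IsStationary P X) (h : ℤ) :
    (autocov P X h)ᵀ = autocov P X (-h) := by
  have h1 := hX.crossMoment_eq h 0
  have h2 := hX.crossMoment_eq 0 h
  rw [sub_zero] at h1
  rw [zero_sub] at h2
  rw [← h1, ← h2, crossMoment_transpose]

lemma autocov_timeReverse (hX : IsStationary P X) (h : ℤ) :
    autocov P (timeReverse X) h = autocov P X (-h) := by
  have h2 := hX.crossMoment_eq 0 h
  rw [zero_sub] at h2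
  rw [← h2]
  ext i j
  simp [autocov, timeReverse, crossMoment]

lemma IsStationary.timeReverse (hX : IsStationary P X) : IsStationary P (timeReverse X) where
  memLp t := hX.memLp (-t)
  mean_zero t := hX.mean_zero (-t)
  cov_eq s t h i j := by
    have := hX.cov_eq (-s) (-t) (-h) i j
    simp only [WhittleVAR.timeReverse, neg_sub]
    simpa only [sub_neg_eq_add, neg_add_eq_sub] using this

lemma IsStationary.memLp_lagSum (hX : IsStationary P X) (A : Coeffs m q) (t : ℤ) :
    MemLp (lagSum X A t) 2 P :=
  memLp_sum_mulVec (fun r : Fin q => hX.memLp (t - ((r : ℤ) + 1))) A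

lemma IsStationary.crossMoment_lagSum (hX : IsStationary P X) (V W : Coeffs m q) (t : ℤ) :
    crossMoment P (lagSum X V t) (lagSum X W t) =
      ∑ r : Fin q, ∑ s : Fin q, V r * autocov P X ((s : ℤ) - (r : ℤ)) * (W s)ᵀ := by
  have hm : ∀ r : Fin q, MemLp (X (t - ((r : ℤ) + 1))) 2 P := fun r => hX.memLp _
  have h1 := crossMoment_sum_mulVec_left Finset.univ hm (hX.memLp_lagSum W t) V
  refine h1.trans (Finset.sum_congr rfl fun r _ => ?_)
  have h2 := crossMoment_sum_mulVec_right Finset.univ (hm r) hm W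
  rw [show crossMoment P (X (t - ((r : ℤ) + 1))) (lagSum X W t) = _ from h2, Finset.mul_sum]
  refine Finset.sum_congr rfl fun s _ => ?_
  rw [hX.crossMoment_eq, mul_assoc,
    show t - ((r : ℤ) + 1) - (t - ((s : ℤ) + 1)) = (s : ℤ) - (r : ℤ) by ring]

lemma IsStationary.crossMoment_lagSum_left (hX : IsStationary P X) (V : Coeffs m q) (t : ℤ)
    {Z : Ω → Fin m → ℝ} (hZ : MemLp Z 2 P) :
    crossMoment P (lagSum X V t) Z =
      ∑ r : Fin q, V r * crossMoment P (X (t - ((r : ℤ) + 1))) Z :=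
  crossMoment_sum_mulVec_left Finset.univ (fun r : Fin q => hX.memLp (t - ((r : ℤ) + 1))) hZ V

lemma indep_past (hε : ∀ t, Measurable (ε t)) (hi : iIndepFun ε P) {s t : ℤ} (h : s < t) :
    Indep (MeasurableSpace.comap (ε t) inferInstance) (past ε s) P := by
  have h1 := indep_iSup_of_disjoint (fun i => (hε i).comap_le) hi
    (S := {t}) (T := {u | u < t}) (by simp)
  simp only [Set.mem_singleton_iff, iSup_iSup_eq_left] at h1
  refine indep_of_indep_of_le_right h1 (iSup_le fun n => ?_)
  exact le_iSup₂_of_le (s - (n : ℤ)) (show s - (n : ℤ) < t by omega) le_rfl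

/-- A function of the innovations up to time `s` is independent of the later innovations. -/
lemma indepFun_of_past (hε : ∀ t, Measurable (ε t)) (hi : iIndepFun ε P) {s t : ℤ} (h : s < t)
    {Y : Ω → ℝ} (hY : AEStronglyMeasurable[past ε s] Y P) : IndepFun (ε t) Y P := by
  obtain ⟨Y', hY', he⟩ := hY
  have h1 : IndepFun (ε t) Y' P := by
    rw [IndepFun_iff_Indep]
    exact indep_of_indep_of_le_right (indep_past hε hi h) hY'.measurable.comap_le
  exact h1.congr (ae_eq_refl _) he.symm

lemma aestronglyMeasurable_past_apply (hX : IsVAR P X ε Φ) {s t : ℤ} (h : s ≤ t) (j : Fin m) :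
    AEStronglyMeasurable[past ε t] (fun ω => X s ω j) P :=
  (continuous_apply j).comp_aestronglyMeasurable ((hX.causal s).mono (past_mono ε h))

/-- Finite sums of functions that are a.e. strongly measurable for a sub-σ-algebra `m'`. -/
lemma aestronglyMeasurable_sum_of_sub {α ι : Type*} {m' m₀ : MeasurableSpace α}
    {μ : Measure[m₀] α} (s : Finset ι) {F : ι → α → ℝ}
    (h : ∀ i, AEStronglyMeasurable[m'] (F i) μ) :
    AEStronglyMeasurable[m'] (fun x => ∑ i ∈ s, F i x) μ := by
  classical
  induction s using Finset.induction_on with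
  | empty => simpa using aestronglyMeasurable_const
  | insert a s ha ih =>
    simp only [Finset.sum_insert ha]
    exact (h a).add ih

lemma aestronglyMeasurable_past_lagSum (hX : IsVAR P X ε Φ) (A : Coeffs m p) (t : ℤ)
    (k : Fin m) : AEStronglyMeasurable[past ε (t - 1)] (fun ω => lagSum X A t ω k) P := by
  simp only [lagSum, Finset.sum_apply, Matrix.mulVec, dotProduct]
  refine aestronglyMeasurable_sum_of_sub _ fun r => aestronglyMeasurable_sum_of_sub _ fun j => ?_
  exact (aestronglyMeasurable_past_apply hX (by omega) j).const_mul _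

lemma IsVAR.crossMoment_innov_eq_zero (hX : IsVAR P X ε Φ) {s t : ℤ} (h : s < t) :
    crossMoment P (ε t) (X s) = 0 := by
  ext i j
  have h1 := indepFun_of_past hX.measurable_innov hX.indep h
    (aestronglyMeasurable_past_apply hX le_rfl j)
  have h2 : IndepFun (fun ω => ε t ω i) (fun ω => X s ω j) P :=
    h1.comp (measurable_pi_apply i) measurable_id
  have h3 := h2.integral_fun_mul_eq_mul_integral ((hX.innov_memLp t).eval i).1
    ((hX.stationary.memLp s).eval j).1
  rw [hX.stationary.mean_zero s j, mul_zero] at h3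
  exact h3

/-- The coefficients of a causal autoregression of order `q` solve the Yule-Walker system of
order `q`. -/
lemma IsVAR.forwardYuleWalker (hX : IsVAR P X ε Φ) : ForwardYuleWalker (autocov P X) Φ := by
  intro s
  have hm := hX.stationary.memLp
  have h1 := hX.crossMoment_innov_eq_zero (s := -((s : ℤ) + 1)) (t := 0) (by omega)
  rw [crossMoment_congr (Filter.EventuallyEq.symm (hX.equation 0)) (ae_eq_refl _),
    show residual X Φ 0 = fun ω => X 0 ω + lagSum X Φ 0 ω from rfl,
    crossMoment_add_left (hm _) (hX.stationary.memLp_lagSum Φ 0) (hm _),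
    hX.stationary.crossMoment_lagSum_left _ _ (hm _)] at h1
  simp only [hX.stationary.crossMoment_eq] at h1
  rw [show (0 : ℤ) - -((s : ℤ) + 1) = s + 1 by ring] at h1
  rw [eq_neg_iff_add_eq_zero, add_comm, ← h1]
  refine congrArg _ (Finset.sum_congr rfl fun r _ => ?_)
  rw [show 0 - ((r : ℤ) + 1) - -((s : ℤ) + 1) = s - r by ring]

lemma IsVAR.crossMoment_self_innov (hX : IsVAR P X ε Φ) (t : ℤ) :
    crossMoment P (X t) (ε t) = crossMoment P (ε t) (ε t) := by
  have hm := hX.stationary.memLp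
  conv_rhs => rw [crossMoment_congr (Filter.EventuallyEq.symm (hX.equation t)) (ae_eq_refl _)]
  rw [show residual X Φ t = fun ω => X t ω + lagSum X Φ t ω from rfl,
    crossMoment_add_left (hm _) (hX.stationary.memLp_lagSum Φ t) (hX.innov_memLp t),
    hX.stationary.crossMoment_lagSum_left _ _ (hX.innov_memLp t), left_eq_add]
  refine Finset.sum_eq_zero fun r _ => ?_
  rw [← crossMoment_transpose, hX.crossMoment_innov_eq_zero (by omega)]
  simp

lemma HasInnovDensity.isProbabilityMeasure_law [IsProbabilityMeasure P]
    {f : (Fin m → ℝ) → ℝ} (hX : IsVAR P X ε Φ) (hf : HasInnovDensity P ε f) :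
    IsProbabilityMeasure (law f) := by
  rw [← hf.map_eq 0]
  exact Measure.isProbabilityMeasure_map (hX.measurable_innov 0).aemeasurable

/-- The Toeplitz matrix of the autocovariances is nonsingular: if `∑ C_r X_{t-r}` is zero, then
its covariances with the innovations show in turn that `C_1, C_2, …` are zero. -/
lemma IsVAR.toeplitz_injective [IsProbabilityMeasure P] (hX : IsVAR P X ε Φ)
    {f : (Fin m → ℝ) → ℝ} (hf : HasInnovDensity P ε f) :
    Function.Injective (toeplitz (p := p) (autocov P X)) := by
  refine (injective_iff_map_eq_zero _).2 fun C hC => ?_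
  have hlaw := hf.isProbabilityMeasure_law hX
  have hzero : ∀ᵐ ω ∂P, lagSum X C 0 ω = 0 := by
    refine ae_eq_zero_of_crossMoment_self (hX.stationary.memLp_lagSum C 0) ?_
    rw [hX.stationary.crossMoment_lagSum, Finset.sum_comm]
    refine Finset.sum_eq_zero fun s _ => ?_
    rw [← Finset.sum_mul, ← toeplitz_apply, hC]
    simp
  -- once `C_1, …, C_n` vanish, the covariance of the sum with `ε_u` is `C_{n+1} E (ε εᵀ)`
  suffices ∀ n (hn : n < p), C ⟨n, hn⟩ = 0 from funext fun r => this r r.2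
  intro n
  induction n using Nat.strong_induction_on with
  | _ n ih =>
  intro hn
  set u : ℤ := 0 - ((n : ℤ) + 1) with hu
  have h1 : crossMoment P (lagSum X C 0) (ε u) = 0 := by
    rw [crossMoment_congr hzero (ae_eq_refl _)]
    ext i j
    simp [crossMoment]
  rw [hX.stationary.crossMoment_lagSum_left _ _ (hX.innov_memLp u),
    Finset.sum_eq_single ⟨n, hn⟩] at h1
  · rw [show 0 - (((⟨n, hn⟩ : Fin p) : ℤ) + 1) = u from rfl, hX.crossMoment_self_innov] at h1
    refine eq_zero_of_mul_crossMoment_self (hX.innov_memLp u) (fun c hc => ?_) h1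
    refine eq_zero_of_ae_dotProduct_eq_zero (f := f) ?_
    rw [← hf.map_eq u, ae_map_iff (hX.measurable_innov u).aemeasurable]
    · exact hc
    · exact (measurableSet_singleton (0 : ℝ)).preimage (by unfold dotProduct; fun_prop)
  · intro r _ hr
    rcases lt_or_ge r.1 n with hlt | hge
    · rw [show C r = 0 from ih r hlt r.2, zero_mul]
    · have : (r : ℕ) ≠ n := fun h => hr (Fin.ext h)
      rw [← crossMoment_transpose, hX.crossMoment_innov_eq_zero (by omega)]
      simp
  · simp

end Moments

/-! ### Fisher information in a linear direction -/

/-- The value `∑ tr (V_r Γ_{s-r} W_sᵀ J)` of the Fisher information between the directions `V`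
and `W` in the space of coefficients. -/
def infoForm (Γ : ℤ → Matrix (Fin m) (Fin m) ℝ) (J : Matrix (Fin m) (Fin m) ℝ)
    (V W : Coeffs m q) : ℝ :=
  ∑ r : Fin q, ∑ s : Fin q, (V r * Γ ((s : ℤ) - (r : ℤ)) * (W s)ᵀ * J).trace

section Fisher

variable [MeasurableSpace Ω] {P : Measure Ω} {X ε : ℤ → Ω → Fin m → ℝ} {Φ : Coeffs m q}
  {f : (Fin m → ℝ) → ℝ} {E : Type*} [AddCommGroup E] [Module ℝ E]

lemma innovInfo_symm (f : (Fin m → ℝ) → ℝ) (i k : Fin m) : innovInfo f i k = innovInfo f k i := by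
  simp [innovInfo, mul_comm]

/-- The information matrix of a differentiable density is nonsingular. -/
lemma HasInnovDensity.eq_zero_of_mul_innovInfo [IsProbabilityMeasure P] (hX : IsVAR P X ε Φ)
    (hf : HasInnovDensity P ε f) {A : Matrix (Fin m) (Fin m) ℝ} (hA : A * innovInfo f = 0) :
    A = 0 := by
  have := hf.isProbabilityMeasure_law hX
  exact eq_zero_of_mul_crossMoment_self (memLp_pi_iff.2 hf.score_memLp)
    (fun c hc => eq_zero_of_ae_dotProduct_densityScore hf.nonneg hf.differentiable hc) hA

lemma measurable_densityScore (f : (Fin m → ℝ) → ℝ) (k : Fin m) :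
    Measurable (densityScore f k) :=
  measurable_fderiv_apply_const ℝ _ _

/-- If the parameterization `θ` runs through the line `Φ + a V`, then the score is
`∇ log f(ε_t) ⬝ (V_1 X_{t-1} + ⋯ + V_q X_{t-q})`. -/
lemma score_ae_eq (hX : IsVAR P X ε Φ) (hf : HasInnovDensity P ε f) {θ : E → Coeffs m q}
    {x v : E} {V : Coeffs m q} (hθ : ∀ a : ℝ, θ (x + a • v) = Φ + a • V) (t : ℤ) :
    ∀ᵐ ω ∂P, score f X θ x v t ω =
      ∑ k, densityScore f k (ε t ω) * lagSum X V t ω k := by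
  -- `log f` need not be differentiable at zeros of `f`, which have probability zero
  have hpos : ∀ᵐ ω ∂P, 0 < f (ε t ω) := by
    refine ae_of_ae_map (hX.measurable_innov t).aemeasurable (p := fun x => 0 < f x) ?_
    rw [hf.map_eq t, ae_law_iff hf.differentiable]
    exact Filter.Eventually.of_forall fun _ => id
  filter_upwards [hpos, hX.equation t] with ω hω he
  simp only [score, logLik, hθ, residual_add_smul, he]
  have h1 : HasDerivAt (fun a : ℝ => ε t ω + a • lagSum X V t ω) (lagSum X V t ω) 0 := by
    simpa using ((hasDerivAt_id (0 : ℝ)).smul_const (lagSum X V t ω)).const_add (ε t ω)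
  have h2 : DifferentiableAt ℝ (fun y => Real.log (f y)) (ε t ω + (0 : ℝ) • lagSum X V t ω) := by
    rw [zero_smul, add_zero]
    exact (hf.differentiable _).log hω.ne'
  have h3 := (h2.hasFDerivAt.comp_hasDerivAt (0 : ℝ) h1).deriv
  rw [zero_smul, add_zero] at h3
  refine h3.trans ?_
  rw [clm_apply_eq_sum]
  exact Finset.sum_congr rfl fun k _ => mul_comm _ _

/-- As `ε_t` is independent of the lagged values, the expectation of a product of two scores is a
sum of products of entries of the information matrix and of autocovariances. -/
lemma hasFisherInfo_infoForm (hX : IsVAR P X ε Φ)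
    (hf : HasInnovDensity P ε f) {θ : E → Coeffs m q} {x v w : E} {V W : Coeffs m q}
    (hV : ∀ a : ℝ, θ (x + a • v) = Φ + a • V) (hW : ∀ a : ℝ, θ (x + a • w) = Φ + a • W) (t : ℤ) :
    HasFisherInfo P f X θ t x v w (infoForm (autocov P X) (innovInfo f) V W) := by
  have hS : ∀ k, MemLp (fun ω => densityScore f k (ε t ω)) 2 P := fun k => by
    have h1 := hf.score_memLp k
    rw [← hf.map_eq t] at h1
    exact h1.comp_of_map (hX.measurable_innov t).aemeasurable
  have hVm := hX.stationary.memLp_lagSum V t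
  have hWm := hX.stationary.memLp_lagSum W t
  have hSS : ∀ k i, Integrable
      (fun ω => densityScore f k (ε t ω) * densityScore f i (ε t ω)) P :=
    fun k i => (hS k).integrable_mul (hS i)
  have hind : ∀ k i, IndepFun (fun ω => densityScore f k (ε t ω) * densityScore f i (ε t ω))
      (fun ω => lagSum X V t ω k * lagSum X W t ω i) P := fun k i =>
    (indepFun_of_past hX.measurable_innov hX.indep (sub_one_lt t)
      ((aestronglyMeasurable_past_lagSum hX V t k).mul
        (aestronglyMeasurable_past_lagSum hX W t i))).comp
      (φ := fun y => densityScore f k y * densityScore f i y)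
      ((measurable_densityScore f k).mul (measurable_densityScore f i)) measurable_id
  have hint : ∀ k i, Integrable (fun ω =>
      (densityScore f k (ε t ω) * densityScore f i (ε t ω)) *
        (lagSum X V t ω k * lagSum X W t ω i)) P := fun k i =>
    (hind k i).integrable_mul (hSS k i) (integrable_mul_apply hVm hWm k i)
  have hJ : ∀ k i, ∫ ω, densityScore f k (ε t ω) * densityScore f i (ε t ω) ∂P =
      innovInfo f k i := fun k i => by
    rw [innovInfo, Matrix.of_apply, ← hf.map_eq t]
    exact (integral_map (hX.measurable_innov t).aemeasurable
      ((measurable_densityScore f k).mul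
        (measurable_densityScore f i)).aestronglyMeasurable).symm
  have heq : (fun ω => score f X θ x v t ω * score f X θ x w t ω) =ᵐ[P] fun ω =>
      ∑ k, ∑ i, (densityScore f k (ε t ω) * densityScore f i (ε t ω)) *
        (lagSum X V t ω k * lagSum X W t ω i) := by
    filter_upwards [score_ae_eq hX hf hV t, score_ae_eq hX hf hW t] with ω h1 h2
    rw [h1, h2, Finset.sum_mul_sum]
    exact Finset.sum_congr rfl fun k _ => Finset.sum_congr rfl fun i _ => by ring
  refine ⟨(integrable_finsetSum _ fun k _ =>
    integrable_finsetSum _ fun i _ => hint k i).congr heq.symm, ?_⟩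
  rw [integral_congr_ae heq,
    integral_finsetSum _ fun k _ => integrable_finsetSum _ fun i _ => hint k i]
  have hform : infoForm (autocov P X) (innovInfo f) V W =
      (crossMoment P (lagSum X V t) (lagSum X W t) * innovInfo f).trace := by
    simp only [hX.stationary.crossMoment_lagSum, infoForm, Finset.sum_mul, Matrix.trace_sum]
  rw [hform, Matrix.trace]
  refine Finset.sum_congr rfl fun k _ => ?_
  rw [integral_finsetSum _ fun i _ => hint k i, Matrix.diag_apply, Matrix.mul_apply]
  refine Finset.sum_congr rfl fun i _ => ?_
  rw [(hind k i).integral_fun_mul_eq_mul_integral (hSS k i).1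
    (integrable_mul_apply hVm hWm k i).1, hJ, innovInfo_symm, mul_comm]
  rfl

lemma hasFisherInfo_iff (hX : IsVAR P X ε Φ)
    (hf : HasInnovDensity P ε f) {θ : E → Coeffs m q} {x v w : E} {V W : Coeffs m q}
    (hV : ∀ a : ℝ, θ (x + a • v) = Φ + a • V) (hW : ∀ a : ℝ, θ (x + a • w) = Φ + a • W) (t : ℤ)
    (c : ℝ) :
    HasFisherInfo P f X θ t x v w c ↔ infoForm (autocov P X) (innovInfo f) V W = c := by
  have h := hasFisherInfo_infoForm hX hf hV hW t
  exact ⟨fun h' => h.2.symm.trans h'.2, fun h' => h' ▸ h⟩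

lemma hasFisherInfo_entryDir (hX : IsVAR P X ε Φ) (hf : HasInnovDensity P ε f) (t : ℤ)
    (r s : Fin q) (k l i j : Fin m) :
    HasFisherInfo P f X id t Φ (entryDir r k l) (entryDir s i j)
      (autocov P X ((s : ℤ) - (r : ℤ)) l j * innovInfo f k i) := by
  rw [hasFisherInfo_iff hX hf (fun _ => rfl) (fun _ => rfl), infoForm,
    Finset.sum_eq_single r (fun r' _ h => by simp [entryDir, h]) (by simp),
    Finset.sum_eq_single s (fun s' _ h => by simp [entryDir, h]) (by simp)]
  simp [entryDir, Matrix.single_mul_mul_single, Matrix.trace_single_mul, innovInfo_symm f i k]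

end Fisher

/-! ### Locally orthogonal reparameterizations -/

section Orthogonal

variable {Γ : ℤ → Matrix (Fin m) (Fin m) ℝ}
  (g : Coeffs m p × Matrix (Fin m) (Fin m) ℝ →ₗ[ℝ] Coeffs m p)

lemma reparam_add_smul (x v : Coeffs m p × Matrix (Fin m) (Fin m) ℝ) (a : ℝ) :
    reparam g (x + a • v) = reparam g x + a • reparam g v := by
  ext1 r
  refine Fin.lastCases ?_ (fun r => ?_) r <;> simp [reparam]

/-- The covariance `∑ W_s Γ_{r-s}` of `W_1 X_{t-1} + ⋯ + W_{p+1} X_{t-p-1}`, where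
`W = (g(0, B), B)`, with the lagged value of index `r`. -/
def crossTerm (Γ : ℤ → Matrix (Fin m) (Fin m) ℝ) (B : Matrix (Fin m) (Fin m) ℝ) (r : Fin p) :
    Matrix (Fin m) (Fin m) ℝ :=
  toeplitz Γ (g (0, B)) r + B * Γ ((r : ℤ) - (p : ℤ))

lemma infoForm_reparam (hΓ : ∀ h, (Γ h)ᵀ = Γ (-h)) (J B : Matrix (Fin m) (Fin m) ℝ)
    (A : Coeffs m p) :
    infoForm Γ J (reparam g (A, 0)) (reparam g (0, B)) =
      ∑ r : Fin p, (g (A, 0) r * ((crossTerm g Γ B r)ᵀ * J)).trace := by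
  have hT : ∀ r : Fin p, (crossTerm g Γ B r)ᵀ =
      ∑ s : Fin (p + 1), Γ ((s : ℤ) - (r : ℤ)) * (reparam g (0, B) s)ᵀ := fun r => by
    rw [Fin.sum_univ_castSucc]
    simp only [crossTerm, toeplitz_apply, Matrix.transpose_add, Matrix.transpose_sum,
      Matrix.transpose_mul, hΓ, neg_sub, reparam, Fin.snoc_castSucc, Fin.snoc_last,
      Fin.val_castSucc, Fin.val_last]
  rw [infoForm, Fin.sum_univ_castSucc]
  have h0 : reparam g (A, 0) (Fin.last p) = 0 := by simp [reparam]
  simp only [h0, zero_mul, Matrix.trace_zero, Finset.sum_const_zero, add_zero]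
  refine Finset.sum_congr rfl fun r _ => ?_
  rw [hT, Finset.sum_mul, Finset.mul_sum, Matrix.trace_sum]
  refine Finset.sum_congr rfl fun s _ => ?_
  simp [reparam, Fin.snoc_castSucc, mul_assoc]

/-- A linear functional of `A` that has the form `∑ tr (g(A, 0)_r K_r)`. -/
def traceFunctional (K : Coeffs m p) : Coeffs m p →ₗ[ℝ] ℝ where
  toFun A := ∑ r : Fin p, (g (A, 0) r * K r).trace
  map_add' A B := by
    have : g (A + B, 0) = g (A, 0) + g (B, 0) := by rw [← map_add]; simp
    simp [this, add_mul, Finset.sum_add_distrib]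
  map_smul' a A := by
    have : g (a • A, 0) = a • g (A, 0) := by rw [← map_smul]; simp
    simp [this, Finset.mul_sum]

/-- The Fisher information entries between `A` and a fixed direction of `B` determine the
matrices they are formed with, as `g(A, 0)` is arbitrary. -/
lemma eq_zero_of_traceFunctional_entryDir (hg : ∀ C, ∃ A, g (A, 0) = C) {K : Coeffs m p}
    (h : ∀ s i j, traceFunctional g K (entryDir s i j) = 0) (r : Fin p) : K r = 0 := by
  have h0 : traceFunctional g K = 0 := by
    refine LinearMap.pi_ext' fun s => Matrix.ext_linearMap ℝ fun i j => ?_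
    ext
    exact h s i j
  obtain ⟨A, hA⟩ := hg (Pi.single r (K r)ᵀ)
  have h1 : traceFunctional g K A = 0 := by rw [h0]; rfl
  have h2 : traceFunctional g K A = ((K r)ᵀ * K r).trace := by
    rw [show traceFunctional g K A = ∑ s : Fin p, (g (A, 0) s * K s).trace from rfl, hA,
      Finset.sum_eq_single r (fun s _ hs => by simp [hs]) (by simp)]
    simp
  rw [h1, ← Matrix.conjTranspose_eq_transpose_of_trivial] at h2
  exact Matrix.trace_conjTranspose_mul_self_eq_zero_iff.1 h2.symm

variable [MeasurableSpace Ω] {P : Measure Ω} [IsProbabilityMeasure P]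
  {X ε : ℤ → Ω → Fin m → ℝ} {Φ : Coeffs m (p + 1)} {f : (Fin m → ℝ) → ℝ}

/-- Local orthogonality of a linear reparameterization means that `crossTerm` vanishes, which is
the backward Yule-Walker system for `g(0, B)`. -/
theorem locallyOrthogonal_iff (hX : IsVAR P X ε Φ) (hf : HasInnovDensity P ε f)
    {Ψp : Coeffs m p} (hΨ : BackwardYuleWalker (autocov P X) Ψp)
    (hg : ∀ C, ∃ A, g (A, 0) = C) {A : Coeffs m p} (hA : reparam g (A, Φ (Fin.last p)) = Φ)
    (t : ℤ) :
    LocallyOrthogonal P f X t g (A, Φ (Fin.last p)) ↔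
      ∀ x r, g x r = g (x.1, 0) r + x.2 * Ψp r.rev := by
  have hdir : ∀ v, ∀ a : ℝ, reparam g ((A, Φ (Fin.last p)) + a • v) = Φ + a • reparam g v :=
    fun v a => by rw [reparam_add_smul, hA]
  simp only [LocallyOrthogonal, hasFisherInfo_iff hX hf (hdir _) (hdir _),
    infoForm_reparam g hX.stationary.autocov_transpose]
  have hinj := hX.toeplitz_injective (p := p) hf
  constructor
  · intro h x r
    have hsingle : ∀ u v, g (0, Matrix.single u v 1) =
        fun r => Matrix.single u v 1 * Ψp r.rev := fun u v => funext fun r =>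
      eq_mul_backward_of_sum_eq_zero hinj hΨ (fun s => Matrix.transpose_eq_zero.1 <|
        hf.eq_zero_of_mul_innovInfo hX <| eq_zero_of_traceFunctional_entryDir g hg
          (K := fun r => (crossTerm g (autocov P X) (Matrix.single u v 1) r)ᵀ * innovInfo f)
          (fun s i j => h s i j u v) s) r
    -- both sides are linear in `B`, so the matrix units suffice
    let L : Matrix (Fin m) (Fin m) ℝ →ₗ[ℝ] Coeffs m p :=
      LinearMap.pi fun r => LinearMap.mulRight ℝ (Ψp r.rev)
    have hL : g ∘ₗ LinearMap.inr ℝ _ _ = L := by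
      refine Matrix.ext_linearMap ℝ fun u v => LinearMap.ext_ring ?_
      exact hsingle u v
    have hx : g x = g (x.1, 0) + g (0, x.2) := by rw [← map_add]; simp
    rw [hx, Pi.add_apply]
    exact congrArg _ (congrFun (LinearMap.congr_fun hL x.2) r)
  · intro h s i j u v
    refine Finset.sum_eq_zero fun r _ => ?_
    have hgB : g (0, Matrix.single u v 1) = fun r => Matrix.single u v 1 * Ψp r.rev := by
      ext1 r
      have h00 : g ((0, 0) : Coeffs m p × Matrix (Fin m) (Fin m) ℝ) = 0 := map_zero g
      rw [h, h00, Pi.zero_apply, zero_add]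
    have h0 : crossTerm g (autocov P X) (Matrix.single u v 1) r = 0 := by
      rw [crossTerm, hgB, toeplitz_apply]
      simp only [mul_assoc]
      rw [← Finset.mul_sum, hΨ r, mul_neg, neg_add_cancel]
    simp [h0]

/-- The Whittle transformation as a linear map. -/
def whittleLinear (Ψ : Coeffs m p) :
    Coeffs m p × Matrix (Fin m) (Fin m) ℝ →ₗ[ℝ] Coeffs m p where
  toFun := whittle Ψ
  map_add' x y := by ext1 r; simp [whittle, add_mul]; abel
  map_smul' a x := by ext1 r; simp [whittle]

lemma locallyOrthogonal_whittle (hX : IsVAR P X ε Φ) (hf : HasInnovDensity P ε f)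
    {Φp Ψp : Coeffs m p} (hΦ : ForwardYuleWalker (autocov P X) Φp)
    (hΨ : BackwardYuleWalker (autocov P X) Ψp) (t : ℤ) :
    LocallyOrthogonal P f X t (whittle Ψp) (Φp, Φ (Fin.last p)) := by
  refine (locallyOrthogonal_iff (whittleLinear Ψp) hX hf hΨ (fun C => ⟨C, ?_⟩) ?_ t).2 ?_
  · ext1 r; simp [whittleLinear, whittle]
  · ext1 r
    refine Fin.lastCases ?_ (fun r => ?_) r
    · simp [reparam]
    · have := whittle_recursion (hX.toeplitz_injective hf) hX.forwardYuleWalker hΦ hΨ r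
      simp [reparam, whittleLinear, whittle, this]
  · intro x r; simp [whittleLinear, whittle]

lemma exists_eq_of_bijective_reparam (hg : Function.Bijective (reparam g)) (C : Coeffs m p) :
    ∃ A, g (A, 0) = C := by
  obtain ⟨⟨A, B⟩, hx⟩ := hg.2 (Fin.snoc (α := fun _ => Matrix (Fin m) (Fin m) ℝ) C 0)
  have hB : B = 0 := by simpa [reparam] using congrFun hx (Fin.last p)
  subst hB
  exact ⟨A, funext fun r => by simpa [reparam] using congrFun hx r.castSucc⟩

lemma locallyOrthogonal_iff_eq_whittle (hX : IsVAR P X ε Φ) (hf : HasInnovDensity P ε f)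
    {Ψp : Coeffs m p} (hΨ : BackwardYuleWalker (autocov P X) Ψp)
    (hg : ∀ A, g (A, 0) = A) {A : Coeffs m p} (hA : reparam g (A, Φ (Fin.last p)) = Φ) (t : ℤ) :
    LocallyOrthogonal P f X t g (A, Φ (Fin.last p)) ↔ ∀ x, g x = whittle Ψp x := by
  rw [locallyOrthogonal_iff g hX hf hΨ (fun C => ⟨C, hg C⟩) hA]
  simp only [hg, funext_iff, whittle]

end Orthogonal

end

end WhittleVAR

end

open WhittleVAR in
theorem mainTheorem6 {Ω : Type*} [MeasurableSpace Ω] (P : Measure Ω) [IsProbabilityMeasure P]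
    (m p : ℕ) (X : ℤ → Ω → Fin m → ℝ) :
    -- forward VAR(p+1)
    (∀ (ε : ℤ → Ω → Fin m → ℝ) (f : (Fin m → ℝ) → ℝ) (Φ : Coeffs m (p + 1)),
      IsVAR P X ε Φ → HasInnovDensity P ε f →
      -- Fisher information of the original parameters
      (∀ (t : ℤ) (r s : Fin (p + 1)) (k l i j : Fin m),
        HasFisherInfo P f X id t Φ (entryDir r k l) (entryDir s i j)
          (autocov P X ((s : ℤ) - (r : ℤ)) l j * innovInfo f k i)) ∧
      -- the order p forward and backward coefficients are well defined
      (∃! Φp : Coeffs m p, ForwardYuleWalker (autocov P X) Φp) ∧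
      (∃! Ψp : Coeffs m p, BackwardYuleWalker (autocov P X) Ψp) ∧
      -- the coefficients of a backward VAR(p) model of X are the latter
      (∀ (η : ℤ → Ω → Fin m → ℝ) (Ψ : Coeffs m p),
        IsVAR P (timeReverse X) η Ψ → BackwardYuleWalker (autocov P X) Ψ) ∧
      ∀ Φp Ψp : Coeffs m p,
        ForwardYuleWalker (autocov P X) Φp → BackwardYuleWalker (autocov P X) Ψp →
        -- the Whittle forward recursion holds and is locally orthogonal
        (∀ r : Fin p, Φ r.castSucc = Φp r + Φ (Fin.last p) * Ψp r.rev) ∧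
        (∀ t : ℤ, LocallyOrthogonal P f X t (whittle Ψp) (Φp, Φ (Fin.last p))) ∧
        -- invertible linear reparameterizations that are locally orthogonal
        (∀ g : Coeffs m p × Matrix (Fin m) (Fin m) ℝ →ₗ[ℝ] Coeffs m p,
          Function.Bijective (reparam g) →
          ∀ A : Coeffs m p, reparam g (A, Φ (Fin.last p)) = Φ →
          ∀ t : ℤ, LocallyOrthogonal P f X t g (A, Φ (Fin.last p)) ↔
            ∀ x r, g x r = g (x.1, 0) r + x.2 * Ψp r.rev) ∧
        -- uniqueness
        (∀ g : Coeffs m p × Matrix (Fin m) (Fin m) ℝ →ₗ[ℝ] Coeffs m p,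
          (∀ A, g (A, 0) = A) →
          ∀ A : Coeffs m p, reparam g (A, Φ (Fin.last p)) = Φ →
          ∀ t : ℤ, LocallyOrthogonal P f X t g (A, Φ (Fin.last p)) ↔
            ∀ x, g x = whittle Ψp x)) ∧
    -- backward VAR(p+1)
    (∀ (ε : ℤ → Ω → Fin m → ℝ) (f : (Fin m → ℝ) → ℝ) (Ψ : Coeffs m (p + 1)),
      IsVAR P (timeReverse X) ε Ψ → HasInnovDensity P ε f →
      (∀ (t : ℤ) (r s : Fin (p + 1)) (k l i j : Fin m),
        HasFisherInfo P f (timeReverse X) id t Ψ (entryDir r k l) (entryDir s i j)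
          (autocov P X ((r : ℤ) - (s : ℤ)) l j * innovInfo f k i)) ∧
      (∃! Φp : Coeffs m p, ForwardYuleWalker (autocov P X) Φp) ∧
      (∃! Ψp : Coeffs m p, BackwardYuleWalker (autocov P X) Ψp) ∧
      (∀ (η : ℤ → Ω → Fin m → ℝ) (Φ : Coeffs m p),
        IsVAR P X η Φ → ForwardYuleWalker (autocov P X) Φ) ∧
      ∀ Φp Ψp : Coeffs m p,
        ForwardYuleWalker (autocov P X) Φp → BackwardYuleWalker (autocov P X) Ψp →
        (∀ r : Fin p, Ψ r.castSucc = Ψp r + Ψ (Fin.last p) * Φp r.rev) ∧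
        (∀ t : ℤ, LocallyOrthogonal P f (timeReverse X) t (whittle Φp) (Ψp, Ψ (Fin.last p))) ∧
        (∀ g : Coeffs m p × Matrix (Fin m) (Fin m) ℝ →ₗ[ℝ] Coeffs m p,
          Function.Bijective (reparam g) →
          ∀ A : Coeffs m p, reparam g (A, Ψ (Fin.last p)) = Ψ →
          ∀ t : ℤ, LocallyOrthogonal P f (timeReverse X) t g (A, Ψ (Fin.last p)) ↔
            ∀ x r, g x r = g (x.1, 0) r + x.2 * Φp r.rev) ∧
        (∀ g : Coeffs m p × Matrix (Fin m) (Fin m) ℝ →ₗ[ℝ] Coeffs m p,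
          (∀ A, g (A, 0) = A) →
          ∀ A : Coeffs m p, reparam g (A, Ψ (Fin.last p)) = Ψ →
          ∀ t : ℤ, LocallyOrthogonal P f (timeReverse X) t g (A, Ψ (Fin.last p)) ↔
            ∀ x, g x = whittle Φp x)) := by
  refine ⟨fun ε f Φ hX hf => ?_, fun ε f Ψ hX hf => ?_⟩
  · have hinj := hX.toeplitz_injective (p := p) hf
    refine ⟨hasFisherInfo_entryDir hX hf, existsUnique_forwardYuleWalker hinj,
      existsUnique_backwardYuleWalker hinj, fun η Ψ hη => ?_, fun Φp Ψp hΦp hΨp =>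
      ⟨whittle_recursion hinj hX.forwardYuleWalker hΦp hΨp,
        locallyOrthogonal_whittle hX hf hΦp hΨp,
        fun g hg A hA t => locallyOrthogonal_iff g hX hf hΨp (exists_eq_of_bijective_reparam g hg)
          hA t,
        fun g hg A hA t => locallyOrthogonal_iff_eq_whittle g hX hf hΨp hg hA t⟩⟩
    rw [backwardYuleWalker_iff_forward_neg, ← funext (autocov_timeReverse hX.stationary)]
    exact hη.forwardYuleWalker
  -- reversing time turns the backward model into a forward one and swaps the two systems
  · have hst : IsStationary P X := timeReverse_timeReverse X ▸ hX.stationary.timeReverse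
    have hneg : (fun h => autocov P X (-h)) = autocov P (timeReverse X) :=
      (funext (autocov_timeReverse hst)).symm
    have hF : ∀ A : Coeffs m p, ForwardYuleWalker (autocov P X) A ↔
        BackwardYuleWalker (autocov P (timeReverse X)) A := fun A => by
      rw [forwardYuleWalker_iff_backward_neg, hneg]
    have hB : ∀ A : Coeffs m p, BackwardYuleWalker (autocov P X) A ↔
        ForwardYuleWalker (autocov P (timeReverse X)) A := fun A => by
      rw [backwardYuleWalker_iff_forward_neg, hneg]
    have hinj := hX.toeplitz_injective (p := p) hf
    simp only [hF, hB]
    refine ⟨fun t r s k l i j => ?_, existsUnique_backwardYuleWalker hinj,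
      existsUnique_forwardYuleWalker hinj, fun η Φ hη => ?_, fun Φp Ψp hΦp hΨp =>
      ⟨whittle_recursion hinj hX.forwardYuleWalker hΨp hΦp,
        locallyOrthogonal_whittle hX hf hΨp hΦp,
        fun g hg A hA t => locallyOrthogonal_iff g hX hf hΦp (exists_eq_of_bijective_reparam g hg)
          hA t,
        fun g hg A hA t => locallyOrthogonal_iff_eq_whittle g hX hf hΦp hg hA t⟩⟩
    · have h := hasFisherInfo_entryDir hX hf t r s k l i j
      rwa [autocov_timeReverse hst, neg_sub] at h
    · rw [← hF]
      exact hη.forwardYuleWalker
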